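/- For a finite tuple of cardinals $\vec\kappa=\langle\kappa_i : i\in I\rangle$ let $X(\vec\kappa)=\prod_{i\in I}\alpha(\kappa_i)$, where $\alpha(\kappa_i)=\kappa_i\amalg\{\infty\}$ is the one-point compactification of the discrete space with $\kappa_i$ points (with $\infty$ isolated if $\kappa_i$ is finite), and let $X(\vec\kappa)^-=X(\vec\kappa)\setminus\{(\infty,\ldots,\infty)\}$. For $A\subseteq I$ let $\mathcal D_A(\vec\kappa)=\{x\in X(\vec\kappa) : x_i\neq\infty \text{ for all } i\in A\}$, and let $\mathcal C_A(\vec\kappa)$ be the group of continuous functions $\mathcal D_A(\vec\kappa)\to\mathbb Z_2$ with the compact-open topology, $\mathbb Z_2$ being discrete. Then $H^k(X(\vec\kappa)^-,\underline{\mathbb Z_2})$ denotes the $k$-th cohomology group of the Čech complex of $X(\vec\kappa)^-$ for the open cover by the sets $\{x : x_i\ne\infty\}$, $i\in I$, a complex which computes the sheaf cohomology of $X(\vec\kappa)^-$ with constant coefficients $\mathbb Z_2$: its $k$-th term ($k\ge 0$) is $\prod_{A\in[I]^{k+1}}\mathcal C_A(\vec\kappa)$, and its differential is $(d\vec f)_{A}=\sum_{i\in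 A} f_{A\setminus\{i\}}|_{\mathcal D_A(\vec\kappa)}$. The group $H^k$ of cocycles modulo coboundaries carries the quotient topology. Let $n,k\ge 0$, let $\vec\kappa=\langle\kappa_0,\ldots,\kappa_n\rangle$ be a tuple of cardinals, and let $B\subseteq\{0,\ldots,n\}$ have exactly $k+1$ elements. Write $\vec\kappa|_B$ for the tuple of the $\kappa_i$ with $i\in B$ and $\vec\kappa^B$ for the tuple of the $\kappa_i$ with $i\notin B$. Suppose there is a continuous map $$\phi : X(\vec\kappa^B)\to H^k(X(\vec\kappa|_B)^-,\underline{\mathbb Z_2})$$ such that 1. $\phi(x)=0$ for every $x\in X(\vec\kappa^B)$ with $x\neq(\infty,\ldots,\infty)$, and 2. $\phi(\infty,\ldots,\infty)\neq 0$. Then $H^k(X(\vec\kappa)^-,\underline{\mathbb Z_2})\neq 0$. (In particular this applies when $\phi$ is induced by a map from $X(\vec\kappa^B)$ to the group of top cocycles, i.e. of all functions $\prod_{i\in B}\kappa_i\to\mathbb Z_2$, which is continuous for the topology of pointwise convergence, whose value at $(\infty,\ldots,\infty)$ is not a coboundary, and all of whose other values are coboundaries.) -/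

import Mathlib

universe u

noncomputable section

namespace Cuboid

open OnePoint

/-- The discrete space with `c` points. -/
def Discrete (c : Cardinal.{u}) : Type u := c.out

instance (c : Cardinal.{u}) : TopologicalSpace (Discrete c) := ⊥

instance (c : Cardinal.{u}) : DiscreteTopology (Discrete c) := ⟨rfl⟩

variable {ι : Type} (κ : ι → Cardinal.{u})

/-- The space `X(κ)`, the product over `i` of the one-point compactifications `α(κ i)` of the
discrete spaces with `κ i` points (if `κ i` is finite, the point `∞` is isolated in `α(κ i)`). -/
abbrev X : Type u := ∀ i, OnePoint (Discrete (κ i))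

/-- The point `(∞, …, ∞)` of `X(κ)`. -/
def inftyPt : X κ := fun _ => ∞

/-- The tuple `κ` restricted to the indices in `B`. -/
abbrev restrict (B : Finset ι) : {i : ι // i ∈ B} → Cardinal.{u} := fun i => κ i

/-- The tuple `κ` with the entries whose index lies in `B` deleted. -/
abbrev delete (B : Finset ι) : {i : ι // i ∉ B} → Cardinal.{u} := fun i => κ i

/-- `𝒟_A(κ)`, the set of points of `X(κ)` whose coordinates in `A` are all different from `∞`.
For nonempty `A` this is the intersection of the members with index in `A` of the open cover
of `X(κ)⁻ = X(κ) \ {(∞, …, ∞)}` by the sets `{x | x i ≠ ∞}`. -/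
def D (A : Finset ι) : Set (X κ) := {x | ∀ i ∈ A, x i ≠ ∞}

lemma D_anti {A A' : Finset ι} (h : A ⊆ A') : D κ A' ⊆ D κ A := fun _ hx i hi => hx i (h hi)

/-- The sets of `k + 1` indices. -/
abbrev Face (ι : Type) (k : ℕ) : Type := {A : Finset ι // A.card = k + 1}

/-- The group of Čech `k`-cochains of `X(κ)⁻` with coefficients in `ℤ/2`: the product over all
`A` with `k + 1` elements of the groups `C(𝒟_A(κ), ℤ/2)` of continuous functions, which carry
the compact-open topology. -/
abbrev Cochain (k : ℕ) : Type u := ∀ A : Face ι k, C(D κ A.1, ZMod 2)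

variable [DecidableEq ι]

/-- The face `A \ {i}` of `A`, for `i ∈ A`. -/
def Face.erase {k : ℕ} (A : Face ι (k + 1)) (i : {i : ι // i ∈ A.1}) : Face ι k :=
  ⟨A.1.erase i.1, by rw [Finset.card_erase_of_mem i.2, A.2]; rfl⟩

/-- Restriction of continuous functions from `𝒟_{A \ {i}}(κ)` to `𝒟_A(κ)`. -/
def res {k : ℕ} (A : Face ι (k + 1)) (i : {i : ι // i ∈ A.1}) :
    C(D κ (A.erase i).1, ZMod 2) →+ C(D κ A.1, ZMod 2) where
  toFun f := f.comp ⟨Set.inclusion (D_anti κ (Finset.erase_subset i.1 A.1)),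
    continuous_inclusion (D_anti κ (Finset.erase_subset i.1 A.1))⟩
  map_zero' := rfl
  map_add' _ _ := rfl

/-- The Čech differential `(d f)_A = ∑_{i ∈ A} f_{A \ {i}}` (no signs are needed over `ℤ/2`). -/
def d (k : ℕ) : Cochain κ k →+ Cochain κ (k + 1) where
  toFun f A := ∑ i : {i : ι // i ∈ A.1}, res κ A i (f (A.erase i))
  map_zero' := by
    funext A
    simp
  map_add' f g := by
    funext A
    simp [Finset.sum_add_distrib]

/-- The group `Z^k` of `k`-cocycles, with the topology induced from the cochains. -/
abbrev cocycles (k : ℕ) : AddSubgroup (Cochain κ k) := (d κ k).ker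

/-- The `k`-coboundaries, as a subgroup of the `k`-cocycles. -/
def coboundaries : (k : ℕ) → AddSubgroup (cocycles κ k)
  | 0 => ⊥
  | k + 1 => (d κ k).range.addSubgroupOf (cocycles κ (k + 1))

/-- The cohomology group `H^k(X(κ)⁻, ℤ/2)`: cocycles modulo coboundaries, with the quotient
topology. -/
abbrev H (k : ℕ) : Type u := cocycles κ k ⧸ coboundaries κ k

end Cuboid

end

namespace Cuboid

open OnePoint Cardinal Filter Topology

/-! The nonzero class at $(\infty,\ldots,\infty)$ enters through the sizes of the $\kappa_i$ with
$i\in B$. Let $k\ge 1$. By `exists_d_eq_of_lt_aleph`, if some $m+1$ of the $k+1$ cardinals in $B$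
lie below $\aleph_m$, every top cochain of $\vec\kappa|_B$ is a coboundary: Kuratowski's
decomposition cuts it into pieces with finite support on the lines in one direction, and such a
piece extends by zero to $\infty$ in that direction. A nonzero top class therefore forces the sorted
entries to satisfy $\kappa_{b_s}\ge\aleph_s$ for $s\le k$.

This size condition passes to the full tuple, where `nontrivial_H_of_aleph_le` builds a nonzero
class however many further indices there are. Its cocycle is $h(x)\prod_{s\ge1}t_s(x_{b_s})$ on the
faces containing $b_1,\ldots,b_k$, with $h$ oscillating along a sequence tending to $\infty$ and
each $t_s$ splitting a set of size $\aleph_s$ in a way no smaller set can hide. In a supposed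
primitive, the coordinates $b_k,\ldots,b_1$ are eliminated one at a time, until a function
continuous at $(\infty,\ldots,\infty)$ would have to oscillate there. Degree 0 is separate:
constants give nonzero classes. -/

/-! ### Infinite combinatorics: decompositions finite on lines. -/

/-- Kuratowski's decomposition: a product of `m + 1` sets of size less than `ℵ_ m` splits into
pieces indexed by the coordinates, the `i`-th of which is finite on each line in direction `i`. -/
theorem exists_finite_line_decomposition {ι : Type} [DecidableEq ι] {Y : ι → Type u} (m : ℕ) :
    ∀ (J : Finset ι) (S : ∀ i, Set (Y i)), J.card = m + 1 → (∀ i ∈ J, #(S i) < ℵ_ m) →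
      ∃ χ : (∀ i, Y i) → ι, (∀ x, χ x ∈ J) ∧ ∀ i ∈ J, ∀ x : ∀ i, Y i,
        (∀ l ∈ J, l ≠ i → x l ∈ S l) → {y ∈ S i | χ (Function.update x i y) = i}.Finite := by
  induction m with
  | zero =>
    intro J S hJ hS
    obtain ⟨a, rfl⟩ := Finset.card_eq_one.1 hJ
    refine ⟨fun _ => a, by simp, fun i hi x _ => ?_⟩
    have := hS i hi
    rw [Nat.cast_zero, aleph_zero, lt_aleph0_iff_set_finite] at this
    exact this.subset (Set.sep_subset _ _)
  | succ m ih =>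
    intro J S hJ hS
    have hne : J.Nonempty := Finset.card_pos.1 (by omega)
    -- Ranking each `S i` in the initial ordinal of `ℵ_ m` makes every initial segment smaller than
    -- `ℵ_ m`, as the induction hypothesis needs.
    let W := (ℵ_ (m : Ordinal.{u})).ord.ToType
    have hW : #W = ℵ_ (m : Ordinal.{u}) := mk_ord_toType _
    have hW0 : Nonempty W := mk_ne_zero_iff.1 (by rw [hW]; exact (aleph_pos _).ne')
    have hρ : ∀ i, ∃ ρ : Y i → W, i ∈ J → Set.InjOn ρ (S i) := by
      intro i
      by_cases hi : i ∈ J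
      · have h1 : #(S i) ≤ #W := by
          rw [hW]
          have := hS i hi
          rw [Nat.cast_succ, ← succ_aleph] at this
          exact Order.lt_succ_iff.1 this
        obtain ⟨e⟩ := h1
        classical
        refine ⟨fun y => if h : y ∈ S i then e ⟨y, h⟩ else Classical.arbitrary W, fun _ => ?_⟩
        intro y hy z hz h
        simp only [hy, hz, dif_pos] at h
        simpa using e.injective h
      · exact ⟨fun _ => Classical.arbitrary W, fun h => absurd h hi⟩
    choose ρ hρ using hρ
    have hIic : ∀ w : W, #(Set.Iic w) < ℵ_ (m : Ordinal.{u}) := by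
      intro w
      have h1 : #(Set.Iio w) < ℵ_ (m : Ordinal.{u}) := by
        have := mk_Iio_lt w (by simp [W])
        rwa [hW] at this
      rw [← Set.Iio_insert]
      exact (mk_insert_le).trans_lt (add_lt_of_lt (aleph0_le_aleph _) h1
        (one_lt_aleph0.trans_le (aleph0_le_aleph _)))
    have key : ∀ (j : ι) (w : W), ∃ χ : (∀ i, Y i) → ι, j ∈ J → (∀ x, χ x ∈ J.erase j) ∧
        ∀ i ∈ J.erase j, ∀ x : ∀ i, Y i, (∀ l ∈ J.erase j, l ≠ i → x l ∈ S l ∧ ρ l (x l) ≤ w) →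
          {y ∈ {y ∈ S i | ρ i y ≤ w} | χ (Function.update x i y) = i}.Finite := by
      intro j w
      by_cases hj : j ∈ J
      · obtain ⟨χ, h⟩ := ih (J.erase j) (fun i => {y ∈ S i | ρ i y ≤ w})
          (by rw [Finset.card_erase_of_mem hj, hJ]; rfl) (by
            intro i hi
            have hi := Finset.mem_of_mem_erase hi
            refine lt_of_le_of_lt ?_ (hIic w)
            refine mk_le_of_injective (f := fun y => ⟨ρ i y.1, y.2.2⟩) ?_
            intro y z h
            exact Subtype.ext (hρ i hi y.2.1 z.2.1 (congrArg Subtype.val h)))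
        exact ⟨χ, fun _ => h⟩
      · exact ⟨fun _ => j, fun h => absurd h hj⟩
    choose χ hχ using key
    have hmax : ∀ x : ∀ i, Y i, ∃ j ∈ J, ∀ i ∈ J, ρ i (x i) ≤ ρ j (x j) := fun x =>
      Finset.exists_max_image J (fun i => ρ i (x i)) hne
    choose top htop hle using hmax
    -- A coordinate of maximal rank is set aside, and the others are coloured inside the initial
    -- segment it bounds.
    refine ⟨fun x => χ (top x) (ρ (top x) (x (top x))) x, fun x =>
      Finset.mem_of_mem_erase ((hχ _ _ (htop x)).1 x), fun i hi x hx => ?_⟩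
    refine (Set.Finite.biUnion J.finite_toSet (t := fun j => {y ∈ S i |
      top (Function.update x i y) = j ∧ χ j (ρ j (Function.update x i y j))
        (Function.update x i y) = i}) ?_).subset ?_
    · intro j hj
      by_cases hji : j = i
      · subst hji
        convert Set.finite_empty
        rw [Set.eq_empty_iff_forall_notMem]
        rintro y ⟨-, -, h⟩
        have h2 := (hχ j (ρ j (Function.update x j y j)) hj).1 (Function.update x j y)
        rw [h] at h2
        simp at h2
      -- As `j ≠ i`, the bound `ρ j (x j)` is constant along the line; a single point `y0` with top
      -- index `j` shows that the fixed coordinates obey it.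
      · rcases Set.eq_empty_or_nonempty {y ∈ S i |
          top (Function.update x i y) = j ∧ χ j (ρ j (Function.update x i y j))
            (Function.update x i y) = i} with h0 | ⟨y0, hy0, ht0, -⟩
        · rw [h0]; exact Set.finite_empty
        · refine ((hχ j (ρ j (x j)) hj).2 i (Finset.mem_erase.2 ⟨Ne.symm hji, hi⟩) x ?_).subset ?_
          · intro l hl hli
            have hl := Finset.mem_of_mem_erase hl
            refine ⟨hx l hl hli, ?_⟩
            have := hle (Function.update x i y0) l hl
            rwa [ht0, Function.update_of_ne hli, Function.update_of_ne hji] at this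
          · rintro y ⟨hy, ht, hc⟩
            have := hle (Function.update x i y) i hi
            rw [ht, Function.update_of_ne hji, Function.update_self] at this
            rw [Function.update_of_ne hji] at hc
            exact ⟨⟨hy, this⟩, hc⟩
    · rintro y ⟨hy, hc⟩
      exact Set.mem_biUnion (htop (Function.update x i y)) ⟨hy, rfl, hc⟩

/-! ### Vanishing of top cohomology for small cardinals. -/

variable {ι : Type} {κ : ι → Cardinal.{u}}

theorem continuous_of_finite_support {c : Cardinal.{u}} {ψ : OnePoint (Discrete c) → ZMod 2}
    (h0 : ψ ∞ = 0) (hfin : {y : Discrete c | ψ y ≠ 0}.Finite) : Continuous ψ := by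
  rw [OnePoint.continuous_iff_from_discrete]
  rw [h0, nhds_discrete, tendsto_pure]
  exact hfin

theorem finite_ne_infty {c : Cardinal.{u}} {ψ : OnePoint (Discrete c) → ZMod 2}
    (h : Continuous ψ) : {y : Discrete c | ψ y ≠ ψ ∞}.Finite := by
  rw [OnePoint.continuous_iff_from_discrete] at h
  have := h.eventually (show ∀ᶠ z in 𝓝 (ψ ∞), z = ψ ∞ by simp [nhds_discrete])
  simpa [Filter.eventually_cofinite] using this

theorem isOpen_coord_eq {i : ι} {z : OnePoint (Discrete (κ i))} (hz : z ≠ ∞) :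
    IsOpen {x : X κ | x i = z} := by
  obtain ⟨y, rfl⟩ := OnePoint.ne_infty_iff_exists.1 hz
  have : IsOpen {((y : Discrete (κ i)) : OnePoint (Discrete (κ i)))} := by
    simpa using OnePoint.isOpenMap_coe {y} (isOpen_discrete _)
  exact IsOpen.preimage (f := fun x : X κ => x i) (continuous_apply i) this

/-- The cochain given by functions on all of `X κ`, the one with index `A` being continuous
on `D κ A`. -/
def cochainOf {k : ℕ} (G : Finset ι → X κ → ZMod 2)
    (hG : ∀ A, A.card = k + 1 → ContinuousOn (G A) (D κ A)) : Cochain κ k :=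
  fun A => ⟨fun x => G A.1 x.1, (hG A.1 A.2).domRestrict⟩

theorem d_apply [DecidableEq ι] {k : ℕ} (f : Cochain κ k) (A : Face ι (k + 1)) (x : D κ A.1) :
    d κ k f A x = ∑ i : {i : ι // i ∈ A.1}, f (A.erase i)
      ⟨x.1, D_anti κ (Finset.erase_subset i.1 A.1) x.2⟩ := by
  simp only [d, AddMonoidHom.coe_mk, ZeroHom.coe_mk, ContinuousMap.coe_sum, Finset.sum_apply]
  rfl

theorem d_cochainOf_apply [DecidableEq ι] {k : ℕ} {G : Finset ι → X κ → ZMod 2}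
    (hG : ∀ A, A.card = k + 1 → ContinuousOn (G A) (D κ A)) (A : Face ι (k + 1)) (x : D κ A.1) :
    d κ k (cochainOf G hG) A x = ∑ i ∈ A.1, G (A.1.erase i) x.1 := by
  rw [d_apply]
  exact Finset.sum_coe_sort A.1 (fun i => G (A.1.erase i) x.1)

/-- If `m + 1` of the `k + 2` cardinals are less than `ℵ_ m`, then every top-dimensional cochain is
a coboundary. -/
theorem exists_d_eq_of_lt_aleph [Fintype ι] [DecidableEq ι] {k m : ℕ} (hι : Fintype.card ι = k + 2)
    (J : Finset ι) (hJ : J.card = m + 1) (hlt : ∀ i ∈ J, κ i < ℵ_ m) (c : Cochain κ (k + 1)) :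
    ∃ g : Cochain κ k, d κ k g = c := by
  classical
  obtain ⟨χ, hχJ, hχ⟩ := exists_finite_line_decomposition (Y := fun i => Discrete (κ i)) m J
    (fun _ => Set.univ) hJ (fun i hi => by simpa [Discrete] using hlt i hi)
  have hU : (Finset.univ : Finset ι).card = k + 1 + 1 := hι
  -- For `A` omitting one index `p`, this is `c` cut down to the points coloured `p`, and 0
  -- elsewhere, in particular where `x p = ∞`.
  let F : Finset ι → X κ → ZMod 2 := fun A x =>
    if h : ∃ z : ∀ i, Discrete (κ i), (∀ l, x l = z l) ∧ χ z ∉ A then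
      c ⟨Finset.univ, hU⟩ ⟨x, fun l _ => by
        obtain ⟨z, hz, -⟩ := h; simp [hz l]⟩ else 0
  have hcont : ∀ A, A.card = k + 1 → ContinuousOn (F A) (D κ A) := by
    intro A hA x hx
    have hcard : Aᶜ.card = 1 := by rw [Finset.card_compl, hA, hι]; omega
    obtain ⟨p, hp⟩ := Finset.card_eq_one.1 hcard
    have hpA : ∀ l, l ∉ A ↔ l = p := fun l => by
      rw [← Finset.mem_compl, hp, Finset.mem_singleton]
    have hxne : ∀ l, l ≠ p → x l ≠ ∞ := fun l hl => hx l (by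
      by_contra h; exact hl ((hpA l).1 h))
    have hline : Continuous fun y : OnePoint (Discrete (κ p)) => F A (Function.update x p y) := by
      apply continuous_of_finite_support
      · simp only [F]
        rw [dif_neg]
        rintro ⟨z, hz, -⟩
        simpa using hz p
      · have hex : ∀ y : Discrete (κ p), F A (Function.update x p y) ≠ 0 →
            ∃ z : ∀ i, Discrete (κ i), (∀ l, l ≠ p → x l = z l) ∧ z p = y ∧ χ z = p := by
          intro y hy
          simp only [F] at hy
          split_ifs at hy with h
          · obtain ⟨z, hz, hzχ⟩ := h
            refine ⟨z, fun l hl => ?_, ?_, (hpA _).1 hzχ⟩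
            · rw [← hz l, Function.update_of_ne hl]
            · have := hz p
              rw [Function.update_self] at this
              exact (OnePoint.coe_injective this).symm
          · exact absurd rfl hy
        rcases Set.eq_empty_or_nonempty {y : Discrete (κ p) | F A (Function.update x p y) ≠ 0}
          with h0 | ⟨y0, hy0⟩
        · rw [h0]; exact Set.finite_empty
        · obtain ⟨w, hw, -, hwp⟩ := hex y0 hy0
          refine (hχ p (hwp ▸ hχJ w) w (fun _ _ _ => trivial)).subset ?_
          intro y hy
          obtain ⟨z, hz, hzy, hzp⟩ := hex y hy
          refine ⟨trivial, ?_⟩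
          have : Function.update w p y = z := by
            funext l
            by_cases hl : l = p
            · subst hl; rw [Function.update_self, hzy]
            · rw [Function.update_of_ne hl]
              exact OnePoint.coe_injective ((hw l hl).symm.trans (hz l hl))
          rw [this, hzp]
    have hG : Continuous fun z : X κ => F A (Function.update x p (z p)) :=
      hline.comp (continuous_apply p)
    -- Near `x` every coordinate except the `p`-th is constant, so continuity on the line in
    -- direction `p` suffices.
    refine (hG.continuousAt.congr ?_).continuousWithinAt
    have : ∀ᶠ z in 𝓝 x, ∀ l, l ≠ p → z l = x l := by
      rw [eventually_all]
      intro l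
      by_cases hl : l = p
      · simp [hl]
      · filter_upwards [(isOpen_coord_eq (hxne l hl)).mem_nhds rfl] with z hz _
        exact hz
    filter_upwards [this] with z hz
    congr 1
    funext l
    by_cases hl : l = p
    · subst hl; simp
    · rw [Function.update_of_ne hl, hz l hl]
  refine ⟨cochainOf F hcont, ?_⟩
  funext A
  have hA : A = ⟨Finset.univ, hU⟩ := Subtype.ext (Finset.eq_univ_of_card _ (by rw [A.2, hι]))
  subst hA
  ext ⟨x, hx⟩
  have hz : ∀ l, ∃ z : Discrete (κ l), x l = z := fun l => by
    obtain ⟨w, hw⟩ := OnePoint.ne_infty_iff_exists.1 (hx l (Finset.mem_univ l))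
    exact ⟨w, hw.symm⟩
  choose z hz using hz
  rw [d_cochainOf_apply, Finset.sum_eq_single_of_mem (χ z) (Finset.mem_univ _)]
  · simp only [F]
    rw [dif_pos ⟨z, hz, by simp⟩]
  · rintro i - hne
    simp only [F]
    rw [dif_neg]
    rintro ⟨w, hw, hwi⟩
    have : w = z := by
      funext l
      exact OnePoint.coe_injective ((hw l).symm.trans (hz l))
    subst this
    simp only [Finset.mem_erase, Finset.mem_univ, and_true, not_not] at hwi
    exact hne hwi.symm

/-! ### Ingredients of the nontrivial cocycle. -/

/-- A sequence converging to `∞` which avoids `∞` and is injective if `c` is infinite, and is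
constant otherwise. -/
theorem exists_seq_tendsto_infty (c : Cardinal.{u}) : ∃ q : ℕ → OnePoint (Discrete c),
    Tendsto q atTop (𝓝 ∞) ∧ (∀ m, IsClopen {q m}) ∧
      (∀ m m', q m = q m' → q m ≠ ∞ → m = m') ∧ (ℵ₀ ≤ c → ∀ m, q m ≠ ∞) := by
  by_cases hc : ℵ₀ ≤ c
  · have : Infinite (Discrete c) := by rw [infinite_iff]; simpa [Discrete] using hc
    let e := Infinite.natEmbedding (Discrete c)
    refine ⟨fun m => e m, ?_, fun m => ⟨isClosed_singleton, ?_⟩, fun m m' h _ => ?_,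
      fun _ m => OnePoint.coe_ne_infty _⟩
    · have h1 : Tendsto e atTop cofinite := by
        rw [← Nat.cofinite_eq_atTop]; exact e.injective.tendsto_cofinite
      have h2 : Tendsto ((↑) : Discrete c → OnePoint (Discrete c)) cofinite (𝓝 ∞) := by
        have := OnePoint.tendsto_coe_infty (X := Discrete c)
        rwa [coclosedCompact_eq_cocompact, cocompact_eq_cofinite] at this
      exact h2.comp h1
    · simpa using OnePoint.isOpenMap_coe {e m} (isOpen_discrete _)
    · exact e.injective (OnePoint.coe_injective h)
  · have : Finite (Discrete c) := by
      rw [← lt_aleph0_iff_finite]; simpa [Discrete] using hc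
    refine ⟨fun _ => ∞, tendsto_const_nhds, fun m => ⟨isClosed_singleton, ?_⟩,
      fun m m' _ h => absurd rfl h, fun h => absurd h hc⟩
    rw [OnePoint.isOpen_iff_of_mem' (Set.mem_singleton _)]
    exact ⟨(Set.toFinite (_ : Set (Discrete c))).isCompact, isOpen_discrete _⟩

/-- A set of size `c` can be split into two halves which no smaller set covers. -/
theorem exists_splitting {Y : Type u} {c : Cardinal.{u}} (hc : ℵ₀ ≤ c) (hY : c ≤ #Y) :
    ∃ (S : Set Y) (t : Y → ZMod 2), #S ≤ c ∧
      ∀ N : Set Y, #N < c → ∃ y ∈ S, ∃ z ∈ S, y ∉ N ∧ z ∉ N ∧ t y + t z = 1 := by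
  classical
  obtain ⟨Z, rfl⟩ : ∃ Z : Type u, #Z = c := ⟨c.out, mk_out c⟩
  have h1 : #(Z × ULift.{u} Bool) = #Z := by
    simpa using mul_eq_left hc (natCast_le_aleph0 (n := 2) |>.trans hc) two_ne_zero
  obtain ⟨e⟩ : Nonempty (Z × ULift.{u} Bool ↪ Y) := by
    rw [← Cardinal.le_def, h1]; exact hY
  refine ⟨Set.range e, fun y => if ∃ a, e (a, ⟨true⟩) = y then 1 else 0, ?_, fun N hN => ?_⟩
  · rw [mk_range_eq _ e.injective, h1]
  -- The traces of `N` on the two copies of `Z` are too small to cover `Z`, so some `a` avoids `N`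
  -- in both.
  · have h2 : ∀ v, #((fun a => e (a, ⟨v⟩)) ⁻¹' N) < #Z := fun v =>
      (mk_preimage_of_injective _ N (fun a b h => by simpa using e.injective h)).trans_lt hN
    have h3 : ((fun a => e (a, ⟨true⟩)) ⁻¹' N ∪ (fun a => e (a, ⟨false⟩)) ⁻¹' N) ≠ Set.univ := by
      intro h
      have := mk_union_le ((fun a => e (a, ⟨true⟩)) ⁻¹' N) ((fun a => e (a, ⟨false⟩)) ⁻¹' N)
      rw [h, mk_univ] at this
      exact absurd this (not_le.2 (add_lt_of_lt hc (h2 _) (h2 _)))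
    obtain ⟨a, ha⟩ := (Set.ne_univ_iff_exists_notMem _).1 h3
    rw [Set.mem_union, not_or] at ha
    refine ⟨_, ⟨(a, ⟨true⟩), rfl⟩, _, ⟨(a, ⟨false⟩), rfl⟩, ha.1, ha.2, ?_⟩
    beta_reduce
    rw [if_pos ⟨a, rfl⟩, if_neg]
    · simp
    · rintro ⟨b, hb⟩
      simpa using e.injective hb

theorem mk_iUnion_finite_lt {I Y : Type u} (N : I → Set Y) (hN : ∀ i, (N i).Finite)
    {r : ℕ} (hI : #I ≤ ℵ_ r) : #(⋃ i, N i) < ℵ_ (r + 1 : ℕ) := by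
  have h1 : #(⋃ i, N i) ≤ ℵ_ (r : Ordinal.{u}) := by
    refine (mk_iUnion_le_sum_mk).trans ((sum_le_sum _ (fun _ => ℵ₀) fun i =>
      (lt_aleph0_iff_set_finite.2 (hN i)).le).trans ?_)
    rw [sum_const']
    exact (mul_le_mul' hI le_rfl).trans (by rw [aleph_mul_aleph0])
  refine h1.trans_lt (aleph_lt_aleph.2 ?_)
  exact_mod_cast Nat.lt_succ_self r

/-- Where `x a ≠ ∞`, the coordinate `x a` is locally constant and determines `m`; locally only one
clopen box can matter. -/
theorem continuousOn_indicator_of_clopen_sequence [Finite ι] (C : Finset ι)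
    (q : ∀ i, ℕ → OnePoint (Discrete (κ i))) (hq : ∀ i m, IsClopen {q i m})
    (hinj : ∀ i m m', q i m = q i m' → q i m ≠ ∞ → m = m') {a : ι} (ha : a ∉ C)
    [∀ x : X κ, Decidable (∃ m, Even m ∧ ∀ i ∉ C, x i = q i m)] :
    ContinuousOn (fun x : X κ => if ∃ m, Even m ∧ ∀ i ∉ C, x i = q i m then (1 : ZMod 2) else 0)
      {x | x a ≠ ∞} := by
  classical
  intro x hx
  have hopen := (isOpen_coord_eq hx).mem_nhds rfl
  refine ContinuousAt.continuousWithinAt ?_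
  by_cases h : ∃ m, q a m = x a
  · obtain ⟨m, hm⟩ := h
    have hcl : IsClopen {z : X κ | ∀ i ∉ C, z i = q i m} := by
      have : {z : X κ | ∀ i ∉ C, z i = q i m} = ⋂ i : {i // i ∉ C}, {z : X κ | z i = q i m} := by
        ext z; simp
      rw [this]
      exact isClopen_iInter_of_finite fun i => (hq i m).preimage (continuous_apply i.1)
    have hG : Continuous fun z : X κ =>
        if Even m ∧ z ∈ {z : X κ | ∀ i ∉ C, z i = q i m} then (1 : ZMod 2) else 0 := by
      by_cases hm : Even m
      · simp only [hm, true_and]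
        exact continuous_const.if (by simp [hcl.frontier_eq]) continuous_const
      · simpa [hm] using continuous_const
    refine hG.continuousAt.congr ?_
    filter_upwards [hopen] with z hz
    have : (∃ m, Even m ∧ ∀ i ∉ C, z i = q i m) ↔ Even m ∧ ∀ i ∉ C, z i = q i m := by
      constructor
      · rintro ⟨m', h1, h2⟩
        have h3 : q a m = q a m' := by rw [hm, ← h2 a ha]; exact hz.symm
        have := hinj a m m' h3 (by rw [hm]; exact hx)
        subst this
        exact ⟨h1, h2⟩
      · exact fun h => ⟨m, h⟩
    simp only [this]
  · refine (continuous_const (y := (0 : ZMod 2))).continuousAt.congr ?_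
    filter_upwards [hopen] with z hz
    rw [if_neg]
    rintro ⟨m, -, h2⟩
    exact h ⟨m, by rw [← h2 a ha]; exact hz⟩

theorem mem_D_update [DecidableEq ι] {A A' : Finset ι} {x : X κ} (hx : x ∈ D κ A) {j : ι}
    (z : OnePoint (Discrete (κ j))) (hA : ∀ i ∈ A', i ≠ j → i ∈ A) (hj : j ∈ A' → z ≠ ∞) :
    Function.update x j z ∈ D κ A' := by
  intro i hi
  by_cases hij : i = j
  · subst hij; rw [Function.update_self]; exact hj hi
  · rw [Function.update_of_ne hij]; exact hx i (hA i hi hij)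

theorem finite_update_ne [DecidableEq ι] {A : Finset ι} {G : X κ → ZMod 2}
    (hG : ContinuousOn G (D κ A)) {j : ι} (hj : j ∉ A) {x : X κ} (hx : x ∈ D κ A) :
    {y : Discrete (κ j) | G (Function.update x j y) ≠ G (Function.update x j ∞)}.Finite := by
  refine finite_ne_infty (ψ := fun z => G (Function.update x j z)) ?_
  exact hG.comp_continuous (continuous_const.update j continuous_id)
    fun z => mem_D_update hx z (fun i hi _ => hi) (fun h => absurd h hj)

/-! ### Eliminating coordinates from a supposed primitive. -/

section Nontrivial

variable [DecidableEq ι] (b : ℕ → ι) (h : X κ → ZMod 2)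
  (t : ∀ s, OnePoint (Discrete (κ (b s))) → ZMod 2)

/-- The family of functions `h(x) * ∏_{1 ≤ s ≤ r} t_s(x_{b s})`, placed at the faces containing
`b 1, …, b r`. -/
def productFamily (r : ℕ) (A : Finset ι) (x : X κ) : ZMod 2 :=
  if (Finset.Icc 1 r).image b ⊆ A then h x * ∏ s ∈ Finset.Icc 1 r, t s (x (b s)) else 0

variable {b h t}

/-- Provides the induction step below: summing over two values of `z` whose `t`-values add to 1
recovers the family at level `r`. -/
theorem productFamily_succ {k r : ℕ} (hr : r < k) (hb : Set.InjOn b (Set.Iic k))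
    (hh : ∀ s ∈ Finset.Icc 1 k, ∀ x z, h (Function.update x (b s) z) = h x)
    (A : Finset ι) (x : X κ) (z : OnePoint (Discrete (κ (b (r + 1))))) :
    productFamily b h t (r + 1) (insert (b (r + 1)) A) (Function.update x (b (r + 1)) z) =
      productFamily b h t r A x * t (r + 1) z := by
  have hne : ∀ s ∈ Finset.Icc 1 r, b s ≠ b (r + 1) := by
    intro s hs heq
    rw [Finset.mem_Icc] at hs
    have := hb (show s ≤ k by omega) (show r + 1 ≤ k by omega) heq
    omega
  have hI : Finset.Icc 1 (r + 1) = insert (r + 1) (Finset.Icc 1 r) := by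
    ext s; simp only [Finset.mem_Icc, Finset.mem_insert]; omega
  have hsub : (Finset.Icc 1 (r + 1)).image b ⊆ insert (b (r + 1)) A ↔
      (Finset.Icc 1 r).image b ⊆ A := by
    rw [hI, Finset.image_insert]
    simp only [Finset.insert_subset_iff, Finset.mem_insert_self, true_and, Finset.image_subset_iff,
      Finset.mem_insert]
    exact ⟨fun H s hs => (H s hs).resolve_left (hne s hs), fun H s hs => Or.inr (H s hs)⟩
  unfold productFamily
  simp only [hsub]
  split_ifs with hA
  · rw [hh (r + 1) (Finset.mem_Icc.2 (by omega)), hI, Finset.prod_insert (by simp),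
      Function.update_self, Finset.prod_congr rfl fun s hs => by
        rw [Function.update_of_ne (hne s hs)]]
    ring
  · simp

/-- The functions `productFamily b h t r` are not coboundaries, even on a set of at most `ℵ_ r`
points, if `h` does not extend continuously to `∞` along a sequence and the functions `t s` are
sufficiently spread out. -/
theorem exists_not_coboundary [Fintype ι] {k : ℕ} (hb : Set.InjOn b (Set.Iic k))
    (hh : ∀ s ∈ Finset.Icc 1 k, ∀ x z, h (Function.update x (b s) z) = h x)
    (p : ℕ → X κ) (hp : Tendsto p atTop (𝓝 (inftyPt κ))) (hp0 : ∀ m, p m (b 0) ≠ ∞)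
    (hhp : ∀ m, h (p m) = if Even m then 1 else 0)
    (ht : ∀ s ∈ Finset.Icc 1 k, ∃ S : Set (Discrete (κ (b s))), #S ≤ ℵ_ s ∧
      ∀ N : Set (Discrete (κ (b s))), #N < ℵ_ s →
        ∃ y ∈ S, ∃ z ∈ S, y ∉ N ∧ z ∉ N ∧ t s y + t s z = 1) (r : ℕ) (hr : r ≤ k) :
    ∃ P : Set (X κ), #P ≤ ℵ_ r ∧ ∀ G : Finset ι → X κ → ZMod 2,
      (∀ A, ContinuousOn (G A) (D κ A)) →
      ¬ ∀ A : Finset ι, A.card = r + 1 → (∀ s, r < s → s ≤ k → b s ∉ A) → ∀ x ∈ P, x ∈ D κ A →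
        ∑ i ∈ A, G (A.erase i) x = productFamily b h t r A x := by
  induction r with
  | zero =>
    -- `G ∅` is continuous at `inftyPt κ`, but would alternate between 1 and 0 along `p`.
    refine ⟨Set.range p, ?_, fun G hG H => ?_⟩
    · rw [Nat.cast_zero, aleph_zero]
      simpa using mk_range_le_lift (f := p)
    have hval : ∀ m, G ∅ (p m) = if Even m then 1 else 0 := by
      intro m
      have := H {b 0} (by simp) (fun s hs hsk hmem => by
        rw [Finset.mem_singleton] at hmem
        have := hb (show s ≤ k from hsk) (Nat.zero_le k) hmem
        omega) (p m) ⟨m, rfl⟩ (by intro i hi; rw [Finset.mem_singleton] at hi; subst hi; exact hp0 m)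
      simpa [productFamily, hhp] using this
    have hcont : ContinuousAt (G ∅) (inftyPt κ) :=
      (hG ∅).continuousAt (by convert Filter.univ_mem; ext; simp [D])
    have hlim := hcont.tendsto.comp hp
    rw [nhds_discrete, tendsto_pure, eventually_atTop] at hlim
    obtain ⟨M, hM⟩ := hlim
    have h1 := hM (2 * M) (by omega)
    have h2 := hM (2 * M + 1) (by omega)
    rw [Function.comp_apply, hval] at h1 h2
    rw [← h1] at h2
    simp at h2
  | succ r ih =>
    obtain ⟨P, hPcard, hP⟩ := ih (by omega)
    obtain ⟨S, hS, hsplit⟩ := ht (r + 1) (Finset.mem_Icc.2 (by omega))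
    refine ⟨Set.image2 (fun (x : X κ) (y : Discrete (κ (b (r + 1)))) =>
      (Function.update x (b (r + 1)) (y : OnePoint _) : X κ)) P S, ?_, fun G hG H => ?_⟩
    · have h1 := mk_image2_le (f := fun (x : X κ) (y : Discrete (κ (b (r + 1)))) =>
        (Function.update x (b (r + 1)) (y : OnePoint _) : X κ)) (s := P) (t := S)
      refine h1.trans ((mul_le_mul' hPcard hS).trans ?_)
      rw [aleph_mul_aleph, max_eq_right (by exact_mod_cast Nat.le_succ r)]
    -- The exceptional values: off their union, which has size below `ℵ_ (r + 1)`, each relevant `G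
    -- A` takes the same value as at `∞`.
    let N : P × Finset ι → Set (Discrete (κ (b (r + 1)))) := fun a =>
      {y | b (r + 1) ∉ a.2 ∧ a.1.1 ∈ D κ a.2 ∧
        G a.2 (Function.update a.1.1 (b (r + 1)) y) ≠ G a.2 (Function.update a.1.1 (b (r + 1)) ∞)}
    have hN : ∀ a, (N a).Finite := by
      rintro ⟨x, A⟩
      by_cases hA : b (r + 1) ∉ A ∧ x.1 ∈ D κ A
      · exact (finite_update_ne (hG A) hA.1 hA.2).subset fun y hy => hy.2.2
      · convert Set.finite_empty
        rw [Set.eq_empty_iff_forall_notMem]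
        exact fun y hy => hA ⟨hy.1, hy.2.1⟩
    have hI : #(P × Finset ι) ≤ ℵ_ (r : Ordinal.{u}) := by
      rw [mk_prod, lift_uzero]
      refine (mul_le_mul' hPcard (lift_le_aleph0.2 (mk_le_aleph0 (α := Finset ι)))).trans ?_
      rw [aleph_mul_aleph0]
    obtain ⟨y, hyS, z, hzS, hyN, hzN, hyz⟩ := hsplit _ (mk_iUnion_finite_lt N hN hI)
    have hGeq : ∀ A : Finset ι, b (r + 1) ∉ A → ∀ x ∈ P, x ∈ D κ A →
        G A (Function.update x (b (r + 1)) y) = G A (Function.update x (b (r + 1)) z) := by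
      intro A hA x hx hxA
      have : ∀ w : Discrete (κ (b (r + 1))), w ∉ ⋃ a, N a →
          G A (Function.update x (b (r + 1)) w) = G A (Function.update x (b (r + 1)) ∞) := by
        intro w hw
        by_contra hne
        exact hw (Set.mem_iUnion.2 ⟨(⟨x, hx⟩, A), hA, hxA, hne⟩)
      rw [this y hyN, this z hzN]
    -- The two slices at `y` and `z` are added: the terms `G A` cancel by `hGeq`, and what remains
    -- is a primitive at level `r`.
    refine hP (fun A x => if b (r + 1) ∈ A then 0 else
      G (insert (b (r + 1)) A) (Function.update x (b (r + 1)) y) +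
        G (insert (b (r + 1)) A) (Function.update x (b (r + 1)) z))
      (fun A => ?_) (fun A hA hbA x hx hxA => ?_)
    · by_cases hjA : b (r + 1) ∈ A
      · simpa [hjA] using continuousOn_const
      · simp only [hjA, if_false]
        have : ∀ w : Discrete (κ (b (r + 1))), ContinuousOn
            (fun x : X κ => G (insert (b (r + 1)) A) (Function.update x (b (r + 1)) w))
            (D κ A) := fun w =>
          (hG (insert (b (r + 1)) A)).comp
            (continuous_id.update (b (r + 1)) continuous_const).continuousOn
            fun x hx => mem_D_update hx _
              (fun i hi hij => (Finset.mem_insert.1 hi).resolve_left hij)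
              fun _ => OnePoint.coe_ne_infty _
        exact (this y).add (this z)
    · have hjA : b (r + 1) ∉ A := hbA (r + 1) (by omega) hr
      have key : ∀ w ∈ S, G A (Function.update x (b (r + 1)) w) +
          ∑ i ∈ A, G (insert (b (r + 1)) (A.erase i)) (Function.update x (b (r + 1)) w) =
          productFamily b h t r A x * t (r + 1) w := by
        intro w hw
        have h1 := H (insert (b (r + 1)) A) (by rw [Finset.card_insert_of_notMem hjA, hA])
          (fun s hs hsk hmem => by
            rcases Finset.mem_insert.1 hmem with h2 | h2
            · have := hb (show s ≤ k from hsk) (show r + 1 ≤ k from hr) h2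
              omega
            · exact hbA s (by omega) hsk h2)
          (Function.update x (b (r + 1)) w) ⟨x, hx, w, hw, rfl⟩
          (mem_D_update hxA _ (fun i hi hij => (Finset.mem_insert.1 hi).resolve_left hij)
            fun _ => OnePoint.coe_ne_infty _)
        rw [productFamily_succ (by omega) hb hh, Finset.sum_insert hjA,
          Finset.erase_insert hjA] at h1
        rw [← h1]
        congr 1
        refine Finset.sum_congr rfl fun i hi => ?_
        rw [Finset.erase_insert_of_ne]
        rintro rfl
        exact hjA hi
      have hsum := congrArg₂ (· + ·) (key y hyS) (key z hzS)
      simp only [← mul_add, hyz, mul_one] at hsum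
      rw [← hsum, hGeq A hjA x hx hxA]
      have hj' : ∀ i, b (r + 1) ∉ A.erase i := fun i hi => hjA (Finset.mem_of_mem_erase hi)
      simp only [hj', if_false, Finset.sum_add_distrib]
      generalize G A (Function.update x (b (r + 1)) z) = v
      have hv : v + v = 0 := CharTwo.add_self_eq_zero v
      linear_combination -hv

end Nontrivial

/-! ### The nonzero class. -/

/-- If `κ (b i) ≥ ℵ_ i` for `k + 2` distinct indices `b 0, …, b (k + 1)`, then the cohomology in
degree `k + 1` does not vanish. -/
theorem nontrivial_H_of_aleph_le [Fintype ι] [DecidableEq ι] {k : ℕ} (b : ℕ → ι)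
    (hb : Set.InjOn b (Set.Iic (k + 1))) (hκ : ∀ s ≤ k + 1, ℵ_ s ≤ κ (b s)) :
    Nontrivial (H κ (k + 1)) := by
  classical
  choose q hq hqcl hqinj hqne using fun i => exists_seq_tendsto_infty (κ i)
  set C := (Finset.Icc 1 (k + 1)).image b with hC
  let h : X κ → ZMod 2 := fun x => if ∃ m, Even m ∧ ∀ i ∉ C, x i = q i m then 1 else 0
  have hsp : ∀ s, ∃ t : OnePoint (Discrete (κ (b s))) → ZMod 2, s ≤ k + 1 →
      ∃ S : Set (Discrete (κ (b s))), #S ≤ ℵ_ s ∧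
      ∀ N : Set (Discrete (κ (b s))), #N < ℵ_ s →
        ∃ y ∈ S, ∃ z ∈ S, y ∉ N ∧ z ∉ N ∧ t y + t z = 1 := by
    intro s
    by_cases hs : s ≤ k + 1
    · obtain ⟨S, t, hS, ht⟩ := exists_splitting (Y := Discrete (κ (b s)))
        (aleph0_le_aleph s) (by simpa [Discrete] using hκ s hs)
      refine ⟨fun z => z.elim 0 t, fun _ => ⟨S, hS, ht⟩⟩
    · exact ⟨0, fun h => absurd h hs⟩
  choose t ht using hsp
  have hCcard : C.card = k + 1 := by
    rw [hC, Finset.card_image_of_injOn]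
    · simp
    · exact hb.mono fun s hs => (Finset.mem_Icc.1 hs).2
  have hb0 : b 0 ∉ C := by
    intro hmem
    obtain ⟨s, hs, hs0⟩ := Finset.mem_image.1 hmem
    rw [Finset.mem_Icc] at hs
    have := hb (show s ≤ k + 1 from hs.2) (Nat.zero_le _) hs0
    omega
  have hcont : ∀ A : Finset ι, A.card = k + 1 + 1 →
      ContinuousOn (productFamily b h t (k + 1) A) (D κ A) := by
    intro A hA
    by_cases hCA : C ⊆ A
    · have : productFamily b h t (k + 1) A =
          fun x => h x * ∏ s ∈ Finset.Icc 1 (k + 1), t s (x (b s)) := by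
        funext x; exact if_pos hCA
      rw [this]
      obtain ⟨a, haA, haC⟩ := Finset.exists_mem_notMem_of_card_lt_card
        (show C.card < A.card by omega)
      have hhcont : ContinuousOn h (D κ A) :=
        (continuousOn_indicator_of_clopen_sequence C q hqcl hqinj haC).mono fun x hx => hx a haA
      have htcont : ContinuousOn (fun x : X κ => ∏ s ∈ Finset.Icc 1 (k + 1), t s (x (b s)))
          (D κ A) := by
        refine continuousOn_finsetProd _ fun s hs => ?_
        intro x hx
        have hs' : x (b s) ≠ ∞ := hx _ (hCA (Finset.mem_image_of_mem b hs))
        refine (ContinuousAt.congr (continuous_const (y := t s (x (b s)))).continuousAt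
          ?_).continuousWithinAt
        filter_upwards [(isOpen_coord_eq hs').mem_nhds rfl] with z hz
        exact congrArg (t s) (Eq.symm hz)
      exact hhcont.mul htcont
    · have : productFamily b h t (k + 1) A = fun x => 0 := by
        funext x; exact if_neg hCA
      rw [this]
      exact continuousOn_const
  let f : Cochain κ (k + 1) := cochainOf (productFamily b h t (k + 1)) hcont
  -- A face of `k + 3` indices containing `C` has exactly two indices outside `C`; deleting either
  -- gives the same term, and these cancel mod 2.
  have hf : d κ (k + 1) f = 0 := by
    funext A
    ext x
    rw [d_cochainOf_apply]
    change _ = (0 : ZMod 2)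
    by_cases hCA : C ⊆ A.1
    · have hcard : (A.1 \ C).card = 2 := by
        rw [Finset.card_sdiff_of_subset hCA, A.2, hCcard]; omega
      obtain ⟨a, a', haa, hpair⟩ := Finset.card_eq_two.1 hcard
      have hval : ∀ i ∈ A.1 \ C, productFamily b h t (k + 1) (A.1.erase i) x.1 =
          h x.1 * ∏ s ∈ Finset.Icc 1 (k + 1), t s (x.1 (b s)) := by
        intro i hi
        refine if_pos fun l hl => Finset.mem_erase.2 ⟨?_, hCA hl⟩
        rintro rfl
        exact (Finset.mem_sdiff.1 hi).2 hl
      rw [← Finset.sum_subset (Finset.sdiff_subset (s := A.1) (t := C)), Finset.sum_congr rfl hval,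
        hpair, Finset.sum_pair haa]
      · exact CharTwo.add_self_eq_zero _
      · intro i hi hiC
        refine if_neg fun hsub => ?_
        have : i ∈ C := by
          by_contra h; exact hiC (Finset.mem_sdiff.2 ⟨hi, h⟩)
        simpa using hsub this
    · exact Finset.sum_eq_zero fun i _ =>
        if_neg fun hsub => hCA (hsub.trans (Finset.erase_subset _ _))
  have hh : ∀ s ∈ Finset.Icc 1 (k + 1), ∀ x z, h (Function.update x (b s) z) = h x := by
    intro s hs x z
    have : ∀ m, (∀ i ∉ C, Function.update x (b s) z i = q i m) ↔ ∀ i ∉ C, x i = q i m := by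
      intro m
      refine forall₂_congr fun i hi => ?_
      rw [Function.update_of_ne]
      rintro rfl
      exact hi (Finset.mem_image_of_mem b hs)
    simp only [h, this]
  have hq0 : ∀ m, q (b 0) m ≠ ∞ := hqne (b 0) (by
    simpa using hκ 0 (Nat.zero_le _))
  obtain ⟨P, -, hP⟩ := exists_not_coboundary (h := h) (t := t) hb hh (fun m i => q i m)
    (tendsto_pi_nhds.2 fun i => hq i) hq0
    (fun m => by
      have : (∃ m', Even m' ∧ ∀ i ∉ C, q i m = q i m') ↔ Even m := by
        constructor
        · rintro ⟨m', h1, h2⟩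
          rwa [hqinj (b 0) m m' (h2 _ hb0) (hq0 m)]
        · exact fun h => ⟨m, h, fun _ _ => rfl⟩
      simp only [h, this])
    (fun s hs => ht s (Finset.mem_Icc.1 hs).2) (k + 1) le_rfl
  refine ⟨⟨QuotientAddGroup.mk ⟨f, hf⟩, 0, fun h0 => ?_⟩⟩
  rw [QuotientAddGroup.eq_zero_iff] at h0
  obtain ⟨g, hg⟩ := AddSubgroup.mem_addSubgroupOf.1 h0
  change d κ k g = f at hg
  refine hP (fun A x => if hx : A.card = k + 1 ∧ x ∈ D κ A then g ⟨A, hx.1⟩ ⟨x, hx.2⟩ else 0)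
    (fun A => ?_) (fun A hA _ x _ hx => ?_)
  · by_cases hA : A.card = k + 1
    · rw [continuousOn_iff_continuous_domRestrict]
      convert (g ⟨A, hA⟩).continuous using 1
      funext x
      simp [Set.domRestrict, hA]
    · simpa [hA] using continuousOn_const
  · have h1 := d_apply g ⟨A, hA⟩ ⟨x, hx⟩
    rw [hg] at h1
    rw [← Finset.sum_coe_sort]
    refine Eq.trans (Finset.sum_congr rfl fun i _ => ?_) h1.symm
    rw [dif_pos ⟨by rw [Finset.card_erase_of_mem i.2, hA]; rfl,
      D_anti κ (Finset.erase_subset i.1 A) hx⟩]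
    rfl

end Cuboid

/-! ### Degree zero, and the passage from the subtuple to the tuple. -/

-- The constant 1 is a cocycle, since a pair has two faces; degree 0 has no nonzero coboundaries.
open Cuboid OnePoint Cardinal in
theorem Cuboid.nontrivial_H_zero {ι : Type} [DecidableEq ι] {κ : ι → Cardinal.{u}} {i : ι}
    (hi : κ i ≠ 0) : Nontrivial (H κ 0) := by
  have hd : d κ 0 (cochainOf (fun _ _ => 1) fun _ _ => continuousOn_const) = 0 := by
    funext A
    ext x
    rw [d_cochainOf_apply]
    simp only [Finset.sum_const, A.2]
    exact (by decide : (0 + 1 + 1) • (1 : ZMod 2) = 0)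
  refine ⟨⟨QuotientAddGroup.mk ⟨_, hd⟩, 0, fun h0 => ?_⟩⟩
  rw [QuotientAddGroup.eq_zero_iff] at h0
  have h1 := congrArg Subtype.val (AddSubgroup.mem_bot.1 h0)
  obtain ⟨y⟩ : Nonempty (Discrete (κ i)) := mk_ne_zero_iff.1 (by simpa [Discrete] using hi)
  have hx : (fun l => if h : l = i then h ▸ (y : OnePoint (Discrete (κ i))) else ∞ : X κ) ∈
      D κ {i} := by
    intro l hl
    rw [Finset.mem_singleton] at hl
    subst hl
    simp
  have h2 := DFunLike.congr_fun (congrFun h1 ⟨{i}, by simp⟩) ⟨_, hx⟩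
  exact one_ne_zero (α := ZMod 2) h2

open Cuboid OnePoint Cardinal in
/-- If the top cohomology of a tuple does not vanish, then its entries can be enumerated so that
the `i`-th entry is at least `ℵ_ i`. -/
theorem Cuboid.exists_enumeration_of_ne_zero {ι : Type} [Fintype ι] [DecidableEq ι]
    {κ : ι → Cardinal.{u}} {k : ℕ} (hι : Fintype.card ι = k + 2) {a : H κ (k + 1)} (ha : a ≠ 0) :
    ∃ b : Fin (k + 2) → ι, Function.Injective b ∧ ∀ s : Fin (k + 2), ℵ_ (s : ℕ) ≤ κ (b s) := by
  let e : Fin (k + 2) ≃ ι := (Fintype.equivFinOfCardEq hι).symm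
  let σ := Tuple.sort (κ ∘ e)
  have hmono : Monotone ((κ ∘ e) ∘ σ) := Tuple.monotone_sort _
  refine ⟨fun s => e (σ s), e.injective.comp σ.injective, fun s => ?_⟩
  by_contra! hlt
  refine ha ?_
  induction a using QuotientAddGroup.induction_on with
  | H c =>
    rw [QuotientAddGroup.eq_zero_iff]
    -- If the `s`-th sorted entry is below `ℵ_ s`, so are all `s + 1` entries up to it.
    obtain ⟨g, hg⟩ := exists_d_eq_of_lt_aleph hι
      ((Finset.Iic s).map (σ.trans e).toEmbedding) (m := s) (by simp)
      (by
        intro i hi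
        obtain ⟨r, hr, rfl⟩ := Finset.mem_map.1 hi
        exact (hmono (Finset.mem_Iic.1 hr)).trans_lt hlt) c.1
    exact AddSubgroup.mem_addSubgroupOf.2 ⟨g, hg⟩

theorem theorem4 (n k : ℕ) (κ : Fin (n + 1) → Cardinal.{u}) (B : Finset (Fin (n + 1)))
    (hB : B.card = k + 1)
    (φ : Cuboid.X (Cuboid.delete κ B) → Cuboid.H (Cuboid.restrict κ B) k)
    (hφ : Continuous φ)
    (hzero : ∀ x, x ≠ Cuboid.inftyPt (Cuboid.delete κ B) → φ x = 0)
    (hinf : φ (Cuboid.inftyPt (Cuboid.delete κ B)) ≠ 0) :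
    Nontrivial (Cuboid.H κ k) := by
  cases k with
  | zero =>
    by_cases h : ∃ i ∈ B, κ i ≠ 0
    · obtain ⟨i, -, hi⟩ := h
      exact Cuboid.nontrivial_H_zero hi
    -- With every `κ i`, `i ∈ B`, equal to 0, the sets `D` of the subtuple's faces are empty, so its
    -- `H` in degree 0 is trivial.
    · push Not at h
      refine absurd ?_ hinf
      generalize φ (Cuboid.inftyPt (Cuboid.delete κ B)) = a
      induction a using QuotientAddGroup.induction_on with
      | H c =>
        rw [QuotientAddGroup.eq_zero_iff]
        refine AddSubgroup.mem_bot.2 (Subtype.ext ?_)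
        funext A
        ext ⟨x, hx⟩
        obtain ⟨i, hi⟩ := Finset.card_pos.1 (show 0 < A.1.card by rw [A.2]; omega)
        obtain ⟨y, -⟩ := OnePoint.ne_infty_iff_exists.1 (hx i hi)
        have h0 : Cardinal.mk (Cuboid.Discrete (Cuboid.restrict κ B i)) = 0 := by
          simpa [Cuboid.Discrete] using h i.1 i.2
        exact ((Cardinal.mk_eq_zero_iff.1 h0).false y).elim
  | succ k =>
    obtain ⟨b, hb, hκ⟩ := Cuboid.exists_enumeration_of_ne_zero (by simpa using hB) hinf
    have hval : ∀ s ≤ k + 1, ((Fin.ofNat (k + 2) s : Fin (k + 2)) : ℕ) = s := fun s hs =>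
      Nat.mod_eq_of_lt (by omega)
    refine Cuboid.nontrivial_H_of_aleph_le (fun s => (b (Fin.ofNat (k + 2) s)).1) ?_ ?_
    · intro s hs s' hs' h
      rw [← hval s hs, ← hval s' hs', hb (Subtype.ext h)]
    · intro s hs
      have := hκ (Fin.ofNat (k + 2) s)
      rwa [hval s hs] at this
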